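/- Let $\mathbb A$ be a finite-dimensional semisimple unital associative real algebra. For a $*$-algebra $\mathbb B$ and a matrix $X\in\mathbb B^{p\times q}$, let $X^{\mathsf H}$ be the transpose of the entrywise involution of $X$, and call $X\in\mathbb B^{p\times p}$ unitary if $X^{\mathsf H}X=I_p$. A $\mathbb B$QRD of $X\in\mathbb B^{p\times q}$ is a decomposition $X=QR$ with $Q\in\mathbb B^{p\times p}$ unitary and $R\in\mathbb B^{p\times q}$ upper triangular; a $\mathbb B$SVD of $X$ is a decomposition $X=UDV^{\mathsf H}$ with $U\in\mathbb B^{p\times p}$, $V\in\mathbb B^{q\times q}$ unitary and $D\in\mathbb B^{p\times q}$ diagonal. The algebras $\mathbb R,\mathbb C,\mathbb H$ carry their usual conjugation. (1) There are $s\ge 0$, algebras $\mathbb A_1,\dots,\mathbb A_s\in\{\mathbb R,\mathbb C,\mathbb H\}$, integers $n_1,\dots,n_s\ge 1$ and an isomorphism of real algebras $\varphi:\mathbb A\to\bigoplus_{k=1}^s\mathbb A_k^{n_k\times n_k}$. (2) Let $\varphi$ be any such isomorphism, and give $\mathbb A$ the involution that corresponds under $\varphi$ to the conjugate transpose in every summand.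 For $m,n\ge 0$, a matrix $X\in\mathbb A^{m\times n}$ and $1\le k\le s$, let $X_k\in\mathbb A_k^{n_km\times n_kn}$ be the block matrix whose $(i,j)$ block is the $k$-th component of $\varphi(X_{ij})$. (A matrix over $\mathbb A$ is the same as the family $(X_k)_k$ of its components, and any family of matrices of these sizes occurs.) Then: (a) every $X_k$ has an $\mathbb A_k$QRD and an $\mathbb A_k$SVD; (b) if $X_k=Q_kR_k$ is an $\mathbb A_k$QRD for each $k$, chosen independently of each other, then the matrices $Q\in\mathbb A^{m\times m}$ and $R\in\mathbb A^{m\times n}$ with components $(Q_k)_k$ and $(R_k)_k$ form an $\mathbb A$QRD $X=QR$; (c) if $X_k=U_kD_kV_k^{\mathsf H}$ is an $\mathbb A_k$SVD for each $k$, chosen independently of each other, then the matrices $U$, $D$, $V$ over $\mathbb A$ with components $(U_k)_k$, $(D_k)_k$, $(V_k)_k$ form an $\mathbb A$SVD $X=UDV^{\mathsf H}$. In particular, every matrix over $\mathbb A$ has an $\mathbb A$QRD and an $\mathbb A$SVD. -/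

import Mathlib

open scoped Matrix Quaternion

section Decompositions

variable {A : Type*} {m n : ℕ}

/-- A rectangular matrix is upper triangular if all entries strictly below the main diagonal
vanish. -/
def IsUpperTri [Zero A] (R : Matrix (Fin m) (Fin n) A) : Prop :=
  ∀ (i : Fin m) (j : Fin n), (j : ℕ) < (i : ℕ) → R i j = 0

/-- A rectangular matrix is diagonal if all entries off the main diagonal vanish. -/
def IsRectDiag [Zero A] (D : Matrix (Fin m) (Fin n) A) : Prop :=
  ∀ (i : Fin m) (j : Fin n), (i : ℕ) ≠ (j : ℕ) → D i j = 0

/-- A square matrix `X` over a `*`-ring is unitary if `Xᴴ X = 1`, where `Xᴴ` is the transpose of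
the entrywise involution of `X`. -/
def IsUnitaryMat [Ring A] [StarRing A] (X : Matrix (Fin m) (Fin m) A) : Prop :=
  Xᴴ * X = 1

/-- `X = Q R` is a QR decomposition over the `*`-ring `A`. -/
structure IsQRD [Ring A] [StarRing A] (X : Matrix (Fin m) (Fin n) A)
    (Q : Matrix (Fin m) (Fin m) A) (R : Matrix (Fin m) (Fin n) A) : Prop where
  eq_mul : X = Q * R
  unitary : IsUnitaryMat Q
  upperTri : IsUpperTri R

/-- `X = U D Vᴴ` is a singular value decomposition over the `*`-ring `A`. -/
structure IsSVD [Ring A] [StarRing A] (X : Matrix (Fin m) (Fin n) A)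
    (U : Matrix (Fin m) (Fin m) A) (D : Matrix (Fin m) (Fin n) A)
    (V : Matrix (Fin n) (Fin n) A) : Prop where
  eq_mul : X = U * D * Vᴴ
  unitary_left : IsUnitaryMat U
  unitary_right : IsUnitaryMat V
  diag : IsRectDiag D

end Decompositions

/-- Names for the three algebras `ℝ`, `ℂ`, `ℍ`. -/
inductive DivKind : Type
  | real
  | complex
  | quaternion

namespace DivKind

/-- The algebra with the given name. -/
def Carrier : DivKind → Type
  | real => ℝ
  | complex => ℂ
  | quaternion => ℍ[ℝ]

/-- The usual division ring structure on `ℝ`, `ℂ`, `ℍ`. -/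
noncomputable instance instDivisionRing : (K : DivKind) → DivisionRing K.Carrier
  | real => inferInstanceAs (DivisionRing ℝ)
  | complex => inferInstanceAs (DivisionRing ℂ)
  | quaternion => inferInstanceAs (DivisionRing ℍ[ℝ])

/-- The usual conjugation on `ℝ` (trivial), `ℂ`, `ℍ`. -/
noncomputable instance instStarRing : (K : DivKind) → StarRing K.Carrier
  | real => inferInstanceAs (StarRing ℝ)
  | complex => inferInstanceAs (StarRing ℂ)
  | quaternion => inferInstanceAs (StarRing ℍ[ℝ])

/-- The usual real algebra structure on `ℝ`, `ℂ`, `ℍ`. -/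
noncomputable instance instAlgebra : (K : DivKind) → Algebra ℝ K.Carrier
  | real => inferInstanceAs (Algebra ℝ ℝ)
  | complex => inferInstanceAs (Algebra ℝ ℂ)
  | quaternion => inferInstanceAs (Algebra ℝ ℍ[ℝ])

end DivKind

/-- The direct sum of the matrix algebras `K₀^{d₀ × d₀} ⊕ ⋯ ⊕ K_{s-1}^{d_{s-1} × d_{s-1}}`, with
componentwise operations; its `star` is the conjugate transpose in every component. -/
abbrev WedderburnForm {s : ℕ} (K : Fin s → DivKind) (d : Fin s → ℕ) : Type :=
  ∀ k : Fin s, Matrix (Fin (d k)) (Fin (d k)) (K k).Carrier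

namespace WedderburnForm

variable {A : Type*} [Ring A] [Algebra ℝ A] {s : ℕ} {K : Fin s → DivKind} {d : Fin s → ℕ}

/-- The involution on `A` that corresponds to the conjugate transpose under the representation
`φ`. -/
@[reducible]
noncomputable def starRingOf (φ : A ≃ₐ[ℝ] WedderburnForm K d) : StarRing A where
  star a := φ.symm (star (φ a))
  star_involutive a := by simp
  star_mul a b := by simp
  star_add a b := by simp

/-- The induced involution fixes the real scalars. -/
theorem star_algebraMap (φ : A ≃ₐ[ℝ] WedderburnForm K d) (r : ℝ) :
    (starRingOf φ).star (algebraMap ℝ A r) = algebraMap ℝ A r := by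
  change φ.symm (star (φ _)) = _
  rw [φ.symm_apply_eq]
  simp only [AlgEquiv.commutes]
  funext k
  simp only [Pi.star_apply, Pi.algebraMap_apply, Matrix.star_eq_conjTranspose]
  rw [Matrix.algebraMap_eq_diagonal, Matrix.diagonal_conjTranspose]
  congr 1
  funext i
  change star (algebraMap ℝ (K k).Carrier r) = algebraMap ℝ (K k).Carrier r
  generalize K k = K
  cases K
  · exact star_trivial (R := ℝ) _
  · exact Complex.conj_ofReal r
  · exact Quaternion.star_coe r

variable {m n : ℕ}

/-- The `k`-th component of a matrix over `A`, read through `φ` as an `m × n` block matrix with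
blocks of size `d k × d k`: the `(i', j')` entry of the `(i, j)` block stands in row
`d k * i + i'` and column `d k * j + j'`. -/
noncomputable def toBlock (φ : A ≃ₐ[ℝ] WedderburnForm K d) (X : Matrix (Fin m) (Fin n) A) (k : Fin s) :
    Matrix (Fin (m * d k)) (Fin (n * d k)) (K k).Carrier :=
  Matrix.of fun p q =>
    φ (X (finProdFinEquiv.symm p).1 (finProdFinEquiv.symm q).1) k
      (finProdFinEquiv.symm p).2 (finProdFinEquiv.symm q).2

/-- The matrix over `A` whose components, read as block matrices, are the given ones. -/
noncomputable def ofBlocks (φ : A ≃ₐ[ℝ] WedderburnForm K d)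
    (Y : ∀ k : Fin s, Matrix (Fin (m * d k)) (Fin (n * d k)) (K k).Carrier) :
    Matrix (Fin m) (Fin n) A :=
  Matrix.of fun i j => φ.symm fun k =>
    Matrix.of fun i' j' => Y k (finProdFinEquiv (i, i')) (finProdFinEquiv (j, j'))

theorem toBlock_ofBlocks (φ : A ≃ₐ[ℝ] WedderburnForm K d)
    (Y : ∀ k : Fin s, Matrix (Fin (m * d k)) (Fin (n * d k)) (K k).Carrier) (k : Fin s) :
    toBlock φ (ofBlocks φ Y) k = Y k := by
  ext p q
  simp only [toBlock, ofBlocks, Matrix.of_apply, AlgEquiv.apply_symm_apply]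
  simp [-finProdFinEquiv_symm_apply]

theorem ofBlocks_toBlock (φ : A ≃ₐ[ℝ] WedderburnForm K d) (X : Matrix (Fin m) (Fin n) A) :
    ofBlocks φ (toBlock φ X) = X := by
  ext i j
  apply φ.injective
  funext k
  ext i' j'
  simp [toBlock, ofBlocks, -finProdFinEquiv_symm_apply]

end WedderburnForm

/-!
The representation of `A` comes from the Wedderburn–Artin theorem, which leaves finite-dimensional
real division algebras as coefficients, and from Frobenius' theorem (`exists_algEquiv_divKind`):
these are `ℝ`, `ℂ`, `ℍ`. For the latter, each element has a real translate with real square, so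
either all elements are real or some `i` has `i * i = -1`. The centralizer of `i` is a copy of `ℂ`
(`exists_eq_add_of_commute`); if it is not everything, conjugation by `i` splits the algebra into
this centralizer and the elements anticommuting with `i`. One of the latter can be scaled to `j`
with `j * j = -1`, and multiplication by `j` exchanges the two parts, which gives `ℍ`.

Over `ℝ`, `ℂ` and `ℍ` the decompositions are obtained uniformly, from `star a * a = ‖a‖ ^ 2` being
a central real number. Householder reflections then work as usual
(`exists_isUnitaryMat_eliminate`) and triangularize a matrix column by column. For the singular
value decomposition no spectral theory is needed: since the unitary matrices form a compact set,
among the `U * X * V` that are diagonal in the first `k` rows and columns there is one with the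
`k`-th diagonal entry of largest norm. If another entry of its `k`-th row or column were nonzero, a
reflection clearing it would increase that norm, so it is diagonal in one more row and column
(`exists_isUnitaryMat_isDiagUpTo`).

Finally, taking components commutes with products and with `ᴴ`, so identities between matrices over
`A` can be checked on components. A block below the diagonal (off the diagonal) consists of entries
of the component matrix below its diagonal (off its diagonal), since row and column blocks have the
same size; so triangular and diagonal components give triangular and diagonal matrices over `A`.
-/

/-! ### Real division algebras -/

/-- Completing the square in the minimal polynomial, whose degree is at most two. -/
theorem exists_sub_algebraMap_mul_self_eq {D : Type*} [DivisionRing D] [Algebra ℝ D]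
    [Module.Finite ℝ D] (x : D) :
    ∃ b e : ℝ, (x - algebraMap ℝ D b) * (x - algebraMap ℝ D b) = algebraMap ℝ D e := by
  have hx : IsIntegral ℝ x := IsIntegral.of_finite ℝ x
  have hp := minpoly.irreducible hx
  have heq := Polynomial.eq_quadratic_of_degree_le_two hp.degree_le_two
  have h0 := minpoly.aeval ℝ x
  generalize (minpoly ℝ x).coeff 2 = a at heq
  generalize (minpoly ℝ x).coeff 1 = b at heq
  generalize (minpoly ℝ x).coeff 0 = c at heq
  rw [heq] at h0
  simp only [map_add, map_mul, Polynomial.aeval_C, map_pow, Polynomial.aeval_X] at h0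
  simp only [← Algebra.smul_def] at h0
  simp only [Algebra.algebraMap_eq_smul_one] at h0
  by_cases ha : a = 0
  · by_cases hb : b = 0
    · exact absurd (minpoly.ne_zero hx) (by
        subst ha hb
        have hc : c = 0 := by simpa using h0
        simp [heq, hc])
    · refine ⟨-c / b, 0, ?_⟩
      have : x = algebraMap ℝ D (-c / b) := by
        subst ha
        rw [Algebra.algebraMap_eq_smul_one]
        have h1 : b • x = (-c) • (1 : D) := by
          linear_combination (norm := module) h0
        rw [div_eq_inv_mul, mul_smul, ← h1, smul_smul, inv_mul_cancel₀ hb, one_smul]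
      rw [← this]
      simp
  · refine ⟨-b / (2 * a), (b ^ 2 - 4 * a * c) / (4 * a ^ 2), ?_⟩
    simp only [Algebra.algebraMap_eq_smul_one, mul_sub, sub_mul, smul_mul_assoc, one_mul,
      mul_smul_comm, mul_one]
    have h1 : x ^ 2 = (-b / a) • x + (-c / a) • (1 : D) := by
      have h2 : a • x ^ 2 = (-b) • x + (-c) • (1 : D) := by
        linear_combination (norm := module) h0
      calc x ^ 2 = a⁻¹ • (a • x ^ 2) := by rw [smul_smul, inv_mul_cancel₀ ha, one_smul]
        _ = _ := by rw [h2]; module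
    rw [← pow_two, h1]
    match_scalars <;> field_simp <;> ring

/-- The centralizer of a square root `i` of `-1` is the copy of `ℂ` spanned by `1` and `i`: some
real translate of `x` has a real square, hence the same square as a real multiple of `1` or `i`,
and with these it commutes. -/
theorem exists_eq_add_of_commute {D : Type*} [DivisionRing D] [Algebra ℝ D]
    [Module.Finite ℝ D] {i x : D} (hi : i * i = -1) (hx : Commute x i) :
    ∃ a b : ℝ, x = a • (1 : D) + b • i := by
  obtain ⟨b, e, h⟩ := exists_sub_algebraMap_mul_self_eq x
  rcases le_total 0 e with he | he
  · have hc : Commute (x - algebraMap ℝ D b) (algebraMap ℝ D √e) :=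
      (Algebra.commutes (√e) _).symm
    have := hc.mul_self_eq_mul_self_iff.1 (by rw [h, ← map_mul, Real.mul_self_sqrt he])
    simp only [Algebra.algebraMap_eq_smul_one] at this
    rcases this with h | h
    · exact ⟨b + √e, 0, by linear_combination (norm := module) h⟩
    · exact ⟨b - √e, 0, by linear_combination (norm := module) h⟩
  · have hc : Commute (x - algebraMap ℝ D b) (√(-e) • i) :=
      (hx.sub_left (Algebra.commutes b _)).smul_right _
    have := hc.mul_self_eq_mul_self_iff.1 (by
      rw [h, smul_mul_smul_comm, hi, Real.mul_self_sqrt (by linarith),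
        Algebra.algebraMap_eq_smul_one]
      module)
    simp only [Algebra.algebraMap_eq_smul_one] at this
    rcases this with h | h
    · exact ⟨b, √(-e), by linear_combination (norm := module) h⟩
    · exact ⟨b, -√(-e), by linear_combination (norm := module) h⟩

theorem exists_smul_mul_self_eq_neg_one {D : Type*} [DivisionRing D] [Algebra ℝ D] {y : D}
    {e : ℝ} (he : e < 0) (hy : y * y = algebraMap ℝ D e) :
    ∃ r : ℝ, r ≠ 0 ∧ (r • y) * (r • y) = -1 := by
  have h0 : √(-e) ≠ 0 := (Real.sqrt_pos.2 (by linarith)).ne'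
  refine ⟨(√(-e))⁻¹, inv_ne_zero h0, ?_⟩
  rw [smul_mul_smul_comm, hy, Algebra.algebraMap_eq_smul_one, smul_smul, ← mul_inv,
    Real.mul_self_sqrt (by linarith), show (-e)⁻¹ * e = -1 by
    rw [inv_neg, neg_mul, inv_mul_cancel₀ he.ne], neg_one_smul]

/-- Frobenius' theorem: a finite-dimensional real division algebra is `ℝ`, `ℂ` or `ℍ`. -/
theorem exists_algEquiv_divKind (D : Type*) [DivisionRing D] [Algebra ℝ D] [Module.Finite ℝ D] :
    ∃ K : DivKind, Nonempty (D ≃ₐ[ℝ] K.Carrier) := by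
  by_cases hR : Function.Surjective (algebraMap ℝ D)
  · exact ⟨.real, ⟨(AlgEquiv.ofBijective (Algebra.ofId ℝ D)
      ⟨(algebraMap ℝ D).injective, hR⟩).symm⟩⟩
  obtain ⟨x, hx⟩ := not_forall.1 hR
  have key : ∀ (y : D) (e : ℝ), 0 ≤ e → y * y = algebraMap ℝ D e →
      ∃ r, algebraMap ℝ D r = y := by
    intro y e he h
    have hc : Commute y (algebraMap ℝ D √e) := (Algebra.commutes (√e) _).symm
    rcases hc.mul_self_eq_mul_self_iff.1 (by rw [h, ← map_mul, Real.mul_self_sqrt he]) with h | h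
    · exact ⟨_, h.symm⟩
    · exact ⟨-√e, by rw [map_neg, h]⟩
  obtain ⟨i, hi⟩ : ∃ i : D, i * i = -1 := by
    obtain ⟨b, e, h⟩ := exists_sub_algebraMap_mul_self_eq x
    rcases le_or_gt 0 e with he | he
    · obtain ⟨r, hr⟩ := key _ e he h
      exact absurd ⟨r + b, by rw [map_add, hr, sub_add_cancel]⟩ hx
    · obtain ⟨r, -, hr⟩ := exists_smul_mul_self_eq_neg_one he h
      exact ⟨_, hr⟩
  by_cases hC : ∀ z : D, Commute z i
  · refine ⟨.complex, ⟨(AlgEquiv.ofBijective (Complex.lift ⟨i, hi⟩)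
      ⟨(Complex.lift ⟨i, hi⟩ : ℂ →ₐ[ℝ] D).toRingHom.injective, fun z => ?_⟩).symm⟩⟩
    obtain ⟨a, b, rfl⟩ := exists_eq_add_of_commute hi (hC z)
    refine ⟨⟨a, b⟩, ?_⟩
    simp [Complex.liftAux_apply, Algebra.algebraMap_eq_smul_one]
  obtain ⟨z, hz⟩ := not_forall.1 hC
  -- the part of `z` anticommuting with `i`
  obtain ⟨j₀, hj₀, hij₀⟩ : ∃ j : D, j ≠ 0 ∧ j * i = -(i * j) := by
    have e₁ : i * (z + i * z * i) = i * z - z * i := by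
      rw [mul_add, ← mul_assoc, ← mul_assoc, hi, neg_one_mul, neg_mul, sub_eq_add_neg]
    have e₂ : (z + i * z * i) * i = z * i - i * z := by
      rw [add_mul, mul_assoc (i * z), hi, mul_neg_one, sub_eq_add_neg]
    refine ⟨z + i * z * i, fun h => hz ?_, by rw [e₁, e₂, neg_sub]⟩
    rw [h, mul_zero] at e₁
    exact (sub_eq_zero.1 e₁.symm).symm
  have hi0 : i ≠ 0 := by
    rintro rfl
    simp at hi
  have hne : i * j₀ ≠ -(i * j₀) := fun h =>
    mul_ne_zero hi0 hj₀ <| by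
      have h2 : (2 : ℝ) • (i * j₀) = 0 := by
        linear_combination (norm := module) h
      exact (smul_eq_zero.1 h2).resolve_left two_ne_zero
  -- `j₀ * j₀` lies in the span of `1` and `i`, and even in `ℝ` since it commutes with `j₀`
  obtain ⟨e, he⟩ : ∃ e, j₀ * j₀ = algebraMap ℝ D e := by
    obtain ⟨a, b, hab⟩ := exists_eq_add_of_commute hi (x := j₀ * j₀) <| by
      rw [commute_iff_eq, mul_assoc, hij₀, mul_neg, ← mul_assoc, hij₀, neg_mul, neg_neg, mul_assoc]
    have hc : j₀ * (j₀ * j₀) = j₀ * j₀ * j₀ := (mul_assoc _ _ _).symm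
    rw [hab, mul_add, add_mul, mul_smul_comm, mul_smul_comm, smul_mul_assoc, smul_mul_assoc,
      mul_one, one_mul, add_right_inj, hij₀] at hc
    by_cases hb : b = 0
    · exact ⟨a, by rw [hab, hb, zero_smul, add_zero, Algebra.algebraMap_eq_smul_one]⟩
    · have h2 : b • (i * j₀ - -(i * j₀)) = 0 := by rw [smul_sub, hc, sub_self]
      exact absurd (sub_eq_zero.1 ((smul_eq_zero.1 h2).resolve_left hb)) hne
  have he0 : e < 0 := by
    by_contra h
    obtain ⟨r, hr⟩ := key _ e (not_lt.1 h) he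
    rw [← hr, Algebra.commutes, hr] at hij₀
    exact hne hij₀
  obtain ⟨r, hr0, hj⟩ := exists_smul_mul_self_eq_neg_one he0 he
  have hji : (r • j₀) * i = -(i * (r • j₀)) := by
    rw [smul_mul_assoc, hij₀, mul_smul_comm, smul_neg]
  generalize r • j₀ = j at hj hji
  let q : QuaternionAlgebra.Basis D (-1 : ℝ) 0 (-1) :=
    { i := i, j := j, k := i * j
      i_mul_i := by rw [hi, zero_smul, add_zero, neg_one_smul]
      j_mul_j := by rw [hj, neg_one_smul]
      i_mul_j := rfl
      j_mul_i := by rw [hji, zero_smul, zero_sub] }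
  let f : ℍ[ℝ] →ₐ[ℝ] D := q.liftHom
  refine ⟨.quaternion, ⟨(AlgEquiv.ofBijective f
    ⟨RingHom.injective (R := ℍ[ℝ]) f.toRingHom, fun x => ?_⟩).symm⟩⟩
  -- split `x` into a part commuting and a part anticommuting with `i`
  obtain ⟨a, b, hab⟩ := exists_eq_add_of_commute hi (x := x - i * x * i) <| by
    rw [commute_iff_eq, sub_mul, mul_sub, mul_assoc (i * x), hi, ← mul_assoc, ← mul_assoc, hi]
    simp [sub_eq_add_neg, add_comm]
  obtain ⟨a', b', hab'⟩ := exists_eq_add_of_commute hi (x := (x + i * x * i) * j) <| by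
    rw [commute_iff_eq, mul_assoc, hji, mul_neg, ← mul_assoc, ← mul_assoc, add_mul, mul_add,
      mul_assoc (i * x), hi, ← mul_assoc, ← mul_assoc, hi]
    rw [neg_one_mul, mul_neg_one, ← neg_mul, neg_add, neg_mul, neg_neg, add_comm]
  have hm : x + i * x * i = -(a' • j + b' • (i * j)) := by
    have := congrArg (· * j) hab'
    rw [mul_assoc _ j j, hj, mul_neg_one, add_mul (a' • (1 : D)), smul_mul_assoc, smul_mul_assoc,
      one_mul] at this
    rw [← this, neg_neg]
  have hx2 : x = (a / 2) • (1 : D) + (b / 2) • i + (-a' / 2) • j + (-b' / 2) • (i * j) := by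
    linear_combination (norm := module) (1 / 2 : ℝ) • hab + (1 / 2 : ℝ) • hm
  refine ⟨⟨a / 2, b / 2, -a' / 2, -b' / 2⟩, ?_⟩
  rw [hx2, ← Algebra.algebraMap_eq_smul_one]
  rfl

/-! ### Unitary matrices over `ℝ`, `ℂ`, `ℍ` -/

section ConjugationAlgebra

/-- A normed real division algebra with an involution for which `star a * a` is the real number
`‖a‖ ^ 2`: the common features of `ℝ`, `ℂ` and `ℍ` that the decompositions rest on. -/
class IsConjugationAlgebra (K : Type*) [NormedDivisionRing K] [StarRing K] [NormedAlgebra ℝ K] :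
    Prop extends CStarRing K, StarModule ℝ K, FiniteDimensional ℝ K where
  star_mul_self_eq (a : K) : star a * a = algebraMap ℝ K (‖a‖ ^ 2)

instance : IsConjugationAlgebra ℝ where
  star_mul_self_eq a := by simp [pow_two]

instance : IsConjugationAlgebra ℂ where
  star_mul_self_eq a := by
    rw [Complex.star_def, ← Complex.normSq_eq_conj_mul_self, Complex.normSq_eq_norm_sq]
    rfl

instance : IsConjugationAlgebra ℍ[ℝ] where
  star_smul r a := by ext <;> simp
  star_mul_self_eq a := by
    rw [Quaternion.star_mul_self, Quaternion.normSq_eq_norm_mul_self, pow_two]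
    rfl

section Unitary

variable {K : Type*} [DivisionRing K] [StarRing K] {n : ℕ}

theorem isUnitaryMat_one : IsUnitaryMat (1 : Matrix (Fin n) (Fin n) K) := by
  simp [IsUnitaryMat]

theorem IsUnitaryMat.mul {U V : Matrix (Fin n) (Fin n) K} (hU : IsUnitaryMat U)
    (hV : IsUnitaryMat V) : IsUnitaryMat (U * V) := by
  unfold IsUnitaryMat at *
  rw [Matrix.conjTranspose_mul, Matrix.mul_assoc, ← Matrix.mul_assoc Uᴴ, hU, Matrix.one_mul, hV]

theorem IsUnitaryMat.mul_conjTranspose {U : Matrix (Fin n) (Fin n) K} (hU : IsUnitaryMat U) :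
    U * Uᴴ = 1 :=
  mul_eq_one_comm.1 hU

theorem IsUnitaryMat.conjTranspose {U : Matrix (Fin n) (Fin n) K} (hU : IsUnitaryMat U) :
    IsUnitaryMat Uᴴ := by
  rw [IsUnitaryMat, Matrix.conjTranspose_conjTranspose, hU.mul_conjTranspose]

end Unitary

variable {K : Type*} [NormedDivisionRing K] [StarRing K] [NormedAlgebra ℝ K]

/-- The Householder reflection along `w`; it is the identity for `w = 0`, the scalar being the junk
value `2 / 0 = 0` then. -/
noncomputable def householder {n : ℕ} (w : Fin n → K) : Matrix (Fin n) (Fin n) K :=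
  1 - (2 / ∑ i, ‖w i‖ ^ 2 : ℝ) • Matrix.vecMulVec w (star w)

theorem householder_mulVec {n : ℕ} (w x : Fin n → K) (i : Fin n) :
    (householder w *ᵥ x) i = x i - (2 / ∑ i, ‖w i‖ ^ 2 : ℝ) • (w i * (star w ⬝ᵥ x)) := by
  rw [householder, Matrix.sub_mulVec, Matrix.one_mulVec, Matrix.smul_mulVec,
    Matrix.vecMulVec_mulVec]
  rfl

variable [IsConjugationAlgebra K]

open IsConjugationAlgebra

theorem star_dotProduct_self_eq {n : ℕ} (w : Fin n → K) :
    star w ⬝ᵥ w = algebraMap ℝ K (∑ i, ‖w i‖ ^ 2) := by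
  simp only [dotProduct, Pi.star_apply, star_mul_self_eq, map_sum]

/-- The entries of a unitary matrix have norm at most one. -/
theorem IsUnitaryMat.norm_apply_le_one {n : ℕ} {U : Matrix (Fin n) (Fin n) K}
    (hU : IsUnitaryMat U) (i j : Fin n) : ‖U i j‖ ≤ 1 := by
  have h1 : (Uᴴ * U) j j = 1 := by rw [show Uᴴ * U = 1 from hU, Matrix.one_apply_eq]
  have h2 : algebraMap ℝ K (∑ i, ‖U i j‖ ^ 2) = algebraMap ℝ K 1 := by
    rw [← star_dotProduct_self_eq, map_one, ← h1]
    rfl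
  have h3 := (algebraMap ℝ K).injective h2
  have h4 := Finset.single_le_sum (f := fun i => ‖U i j‖ ^ 2) (fun i _ => sq_nonneg _)
    (Finset.mem_univ i)
  rw [h3] at h4
  exact (sq_le_one_iff₀ (norm_nonneg _)).1 h4

theorem isCompact_setOf_isUnitaryMat (n : ℕ) :
    IsCompact {U : Matrix (Fin n) (Fin n) K | IsUnitaryMat U} := by
  have : ProperSpace K := FiniteDimensional.proper ℝ K
  refine IsCompact.of_isClosed_subset (s := Set.univ.pi fun _ : Fin n =>
    Set.univ.pi fun _ : Fin n => Metric.closedBall (0 : K) 1)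
    (isCompact_univ_pi fun _ => isCompact_univ_pi fun _ => isCompact_closedBall _ _) ?_ ?_
  · exact isClosed_eq (by fun_prop) continuous_const
  · intro U hU i _ j _
    simpa using hU.norm_apply_le_one i j

theorem conjTranspose_householder {n : ℕ} (w : Fin n → K) :
    (householder w)ᴴ = householder w := by
  rw [householder, Matrix.conjTranspose_sub, Matrix.conjTranspose_one,
    Matrix.conjTranspose_smul, Matrix.conjTranspose_vecMulVec, star_star, star_trivial]

theorem isUnitaryMat_householder {n : ℕ} (w : Fin n → K) : IsUnitaryMat (householder w) := by
  rw [IsUnitaryMat, conjTranspose_householder]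
  have h : Matrix.vecMulVec w (star w) * Matrix.vecMulVec w (star w) =
      (∑ i, ‖w i‖ ^ 2 : ℝ) • Matrix.vecMulVec w (star w) := by
    rw [Matrix.vecMulVec_mul_vecMulVec, star_dotProduct_self_eq]
    ext i j
    rw [Matrix.vecMulVec_apply, Matrix.smul_apply, Matrix.vecMulVec_apply, Pi.smul_apply,
      smul_eq_mul, ← Algebra.smul_def, mul_smul_comm]
  rw [householder, sub_mul, mul_sub, mul_sub, mul_one, one_mul, mul_one, smul_mul_smul_comm, h]
  by_cases h0 : (∑ i, ‖w i‖ ^ 2 : ℝ) = 0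
  · simp [h0]
  · match_scalars <;> field_simp
    ring

/-- Householder elimination in the rows from `k` on: a unitary matrix acting on the coordinates from
`k` on only, which moves the whole norm of that part of `x` into the `k`-th coordinate. -/
theorem exists_isUnitaryMat_eliminate {n : ℕ} (x : Fin n → K) (k : Fin n) :
    ∃ H : Matrix (Fin n) (Fin n) K, IsUnitaryMat H ∧
      (∀ y : Fin n → K, (∀ i, k ≤ i → y i = 0) → H *ᵥ y = y) ∧
      (∀ (y : Fin n → K) (i : Fin n), i < k → (H *ᵥ y) i = y i) ∧
      (∀ i, k < i → (H *ᵥ x) i = 0) ∧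
      (∀ i, k < i → x i ≠ 0 → ‖x k‖ < ‖(H *ᵥ x) k‖) := by
  obtain ⟨u, hu, hux⟩ : ∃ u : K, ‖u‖ = 1 ∧ ‖x k‖ • u = x k := by
    by_cases h : x k = 0
    · exact ⟨1, by simp, by simp [h]⟩
    · have h' : ‖x k‖ ≠ 0 := norm_ne_zero_iff.2 h
      exact ⟨‖x k‖⁻¹ • x k, by rw [norm_smul, norm_inv, norm_norm, inv_mul_cancel₀ h'],
        by rw [smul_smul, mul_inv_cancel₀ h', one_smul]⟩
  let T : ℝ := ∑ i, if k < i then ‖x i‖ ^ 2 else 0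
  have hT : 0 ≤ T := Finset.sum_nonneg fun i _ => by split_ifs <;> positivity
  let r : ℝ := √(T + ‖x k‖ ^ 2)
  have hr : r ^ 2 = T + ‖x k‖ ^ 2 := Real.sq_sqrt (by positivity)
  have hr0 : 0 ≤ r := Real.sqrt_nonneg _
  -- the reflection along `x' - (-r • u) e_k`, with `x'` the part of `x` from `k` on
  let w : Fin n → K := fun i => if k < i then x i else if i = k then x k + r • u else 0
  have hwk : w k = (‖x k‖ + r) • u := by simp [w, add_smul, hux]
  have huu : star u * u = 1 := by rw [star_mul_self_eq, hu, one_pow, map_one]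
  have hN : ∑ i, ‖w i‖ ^ 2 = 2 * (r ^ 2 + r * ‖x k‖) := by
    have : ∀ i, ‖w i‖ ^ 2 =
        (if k < i then ‖x i‖ ^ 2 else 0) + if i = k then (‖x k‖ + r) ^ 2 else 0 := by
      intro i
      by_cases h : i = k
      · subst h
        rw [hwk, norm_smul, hu, mul_one, Real.norm_of_nonneg (by positivity)]
        simp
      · by_cases h' : k < i <;> simp [w, h, h']
    rw [Finset.sum_congr rfl fun i _ => this i, Finset.sum_add_distrib, Finset.sum_ite_eq']
    simp only [Finset.mem_univ, if_true]
    change T + _ = _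
    linear_combination (-1 : ℝ) * hr
  have hwx : star w ⬝ᵥ x = algebraMap ℝ K (r ^ 2 + r * ‖x k‖) := by
    have : ∀ i, star (w i) * x i =
        algebraMap ℝ K ((if k < i then ‖x i‖ ^ 2 else 0) +
          if i = k then (‖x k‖ + r) * ‖x k‖ else 0) := by
      intro i
      by_cases h : i = k
      · subst h
        rw [hwk]
        nth_rw 2 [← hux]
        rw [star_smul, smul_mul_smul_comm, huu]
        simp [Algebra.algebraMap_eq_smul_one]
      · by_cases h' : k < i <;> simp [w, h, h', star_mul_self_eq]
    simp only [dotProduct, Pi.star_apply]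
    rw [Finset.sum_congr rfl fun i _ => this i, ← map_sum, Finset.sum_add_distrib,
      Finset.sum_ite_eq']
    simp only [Finset.mem_univ, if_true]
    congr 1
    change T + _ = _
    linear_combination (-1 : ℝ) * hr
  have hHx : ∀ i, (householder w *ᵥ x) i = x i - w i := by
    intro i
    rw [householder_mulVec, hwx, hN, ← Algebra.commutes, ← Algebra.smul_def, smul_smul]
    by_cases h0 : r ^ 2 + r * ‖x k‖ = 0
    · have : w i = 0 := by
        have h := hN
        rw [h0, mul_zero, Finset.sum_eq_zero_iff_of_nonneg (fun i _ => sq_nonneg _)] at h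
        simpa using h i (Finset.mem_univ i)
      rw [this, smul_zero]
    · rw [show 2 / (2 * (r ^ 2 + r * ‖x k‖)) * (r ^ 2 + r * ‖x k‖) = 1 by
        rw [← div_div, div_self two_ne_zero, one_div, inv_mul_cancel₀ h0], one_smul]
  refine ⟨householder w, isUnitaryMat_householder w, fun y hy => ?_, fun y i hi => ?_,
    fun i hi => ?_, fun i hi hxi => ?_⟩
  · have h : star w ⬝ᵥ y = 0 := Finset.sum_eq_zero fun i _ => by
      by_cases h : k ≤ i
      · rw [hy i h, mul_zero]
      · simp [w, (not_le.1 h).not_gt, (not_le.1 h).ne]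
    ext i
    rw [householder_mulVec, h, mul_zero, smul_zero, sub_zero]
  · rw [householder_mulVec]
    simp [w, hi.not_gt, hi.ne]
  · simp [hHx, w, hi]
  · have h : (householder w *ᵥ x) k = -(r • u) := by simp [hHx, w]
    rw [h, norm_neg, norm_smul, hu, mul_one, Real.norm_of_nonneg hr0]
    refine lt_of_pow_lt_pow_left₀ 2 hr0 ?_
    have h1 : (if k < i then ‖x i‖ ^ 2 else 0) ≤ T :=
      Finset.single_le_sum (f := fun i => if k < i then ‖x i‖ ^ 2 else 0)
        (fun i _ => by split_ifs <;> positivity) (Finset.mem_univ i)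
    rw [if_pos hi] at h1
    have h2 : 0 < ‖x i‖ ^ 2 := by positivity
    linarith

/-! ### QR and singular value decompositions over `ℝ`, `ℂ`, `ℍ` -/

/-- `B` is diagonal in its first `k` rows and columns. -/
def IsDiagUpTo {K : Type*} [Zero K] {m n : ℕ} (k : ℕ) (B : Matrix (Fin m) (Fin n) K) : Prop :=
  ∀ (i : Fin m) (j : Fin n), (i : ℕ) ≠ j → (i : ℕ) < k ∨ (j : ℕ) < k → B i j = 0

theorem isClosed_setOf_isDiagUpTo {K : Type*} [NormedDivisionRing K] {m n : ℕ} (k : ℕ) :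
    IsClosed {B : Matrix (Fin m) (Fin n) K | IsDiagUpTo k B} := by
  simp only [IsDiagUpTo, Set.ofPred_forall]
  exact isClosed_iInter fun i => isClosed_iInter fun j => isClosed_iInter fun _ =>
    isClosed_iInter fun _ => isClosed_eq (continuous_id.matrix_elem i j) continuous_const

theorem IsDiagUpTo.conjTranspose {K : Type*} [DivisionRing K] [StarRing K] {m n k : ℕ}
    {B : Matrix (Fin m) (Fin n) K} (hB : IsDiagUpTo k B) :
    IsDiagUpTo k Bᴴ := fun i j hij hk => by
  rw [Matrix.conjTranspose_apply, hB j i hij.symm hk.symm, star_zero]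

variable {m n : ℕ}

/-- Unitary triangularization of the first `k` columns. -/
theorem exists_isUnitaryMat_mul_eq_zero (X : Matrix (Fin m) (Fin n) K) (k : ℕ) :
    ∃ U : Matrix (Fin m) (Fin m) K, IsUnitaryMat U ∧
      ∀ (i : Fin m) (j : Fin n), (j : ℕ) < k → (j : ℕ) < i → (U * X) i j = 0 := by
  induction k with
  | zero => exact ⟨1, isUnitaryMat_one, fun i j h => absurd h (Nat.not_lt_zero _)⟩
  | succ k ih =>
    obtain ⟨U, hU, h⟩ := ih
    by_cases hk : k < m ∧ k < n
    · obtain ⟨H, hH, hfix, -, helim, -⟩ := exists_isUnitaryMat_eliminate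
        ((U * X).col ⟨k, hk.2⟩) ⟨k, hk.1⟩
      refine ⟨H * U, hH.mul hU, fun i j hj hji => ?_⟩
      rw [Matrix.mul_assoc]
      change (H *ᵥ (U * X).col j) i = 0
      rcases Nat.lt_succ_iff_lt_or_eq.1 hj with hj | hj
      · rw [hfix ((U * X).col j) fun i' hi' => h i' j hj (lt_of_lt_of_le hj hi')]
        exact h i j hj hji
      · obtain rfl : j = ⟨k, hk.2⟩ := Fin.ext hj
        exact helim i hji
    · refine ⟨U, hU, fun i j hj hji => h i j ?_ hji⟩
      have := i.isLt
      have := j.isLt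
      omega

theorem exists_isQRD (X : Matrix (Fin m) (Fin n) K) : ∃ Q R, IsQRD X Q R := by
  obtain ⟨U, hU, h⟩ := exists_isUnitaryMat_mul_eq_zero X n
  refine ⟨Uᴴ, U * X, ?_, hU.conjTranspose, fun i j hij => h i j j.isLt hij⟩
  rw [← Matrix.mul_assoc, show Uᴴ * U = 1 from hU, Matrix.one_mul]

/-- Clearing the `k`-th column below the diagonal by a unitary matrix keeps the first `k` rows and
columns diagonal, and increases the norm of the `k`-th diagonal entry unless there is nothing to
clear. -/
theorem IsDiagUpTo.exists_isUnitaryMat_mul {k : ℕ} {B : Matrix (Fin m) (Fin n) K}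
    (hB : IsDiagUpTo k B) {i₀ : Fin m} (hi₀ : k < i₀) (hm : k < m) (hn : k < n)
    (hne : B i₀ ⟨k, hn⟩ ≠ 0) :
    ∃ H : Matrix (Fin m) (Fin m) K, IsUnitaryMat H ∧ IsDiagUpTo k (H * B) ∧
      ‖B ⟨k, hm⟩ ⟨k, hn⟩‖ < ‖(H * B) ⟨k, hm⟩ ⟨k, hn⟩‖ := by
  obtain ⟨H, hH, hfix, hrow, -, hlt⟩ := exists_isUnitaryMat_eliminate (B.col ⟨k, hn⟩) ⟨k, hm⟩
  refine ⟨H, hH, fun i j hij hk => ?_, hlt i₀ hi₀ hne⟩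
  change (H *ᵥ B.col j) i = 0
  by_cases hj : (j : ℕ) < k
  · rw [hfix (B.col j) fun i' hi' => hB i' j (lt_of_lt_of_le hj hi').ne' (.inr hj)]
    exact hB i j hij hk
  · rw [hrow _ _ (hk.resolve_right hj)]
    exact hB i j hij hk

/-- Among the pairs of unitary matrices that diagonalize the first `k` rows and columns, a pair for
which the `k`-th diagonal entry is largest also diagonalizes the `k`-th row and column. -/
theorem exists_isUnitaryMat_isDiagUpTo (X : Matrix (Fin m) (Fin n) K) (k : ℕ) :
    ∃ (U : Matrix (Fin m) (Fin m) K) (V : Matrix (Fin n) (Fin n) K),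
      IsUnitaryMat U ∧ IsUnitaryMat V ∧ IsDiagUpTo k (U * X * V) := by
  induction k with
  | zero => exact ⟨1, 1, isUnitaryMat_one, isUnitaryMat_one, fun i j _ h => by simp at h⟩
  | succ k ih =>
    by_cases hk : k < m ∧ k < n
    · obtain ⟨hm, hn⟩ := hk
      let S : Set (Matrix (Fin m) (Fin m) K × Matrix (Fin n) (Fin n) K) :=
        ({U | IsUnitaryMat U} ×ˢ {V | IsUnitaryMat V}) ∩
          (fun p => p.1 * X * p.2) ⁻¹' {B | IsDiagUpTo k B}
      have hcont : Continuous fun p : Matrix (Fin m) (Fin m) K × Matrix (Fin n) (Fin n) K =>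
        p.1 * X * p.2 := by fun_prop
      have hS : IsCompact S :=
        ((isCompact_setOf_isUnitaryMat m).prod (isCompact_setOf_isUnitaryMat n)).inter_right
          ((isClosed_setOf_isDiagUpTo k).preimage hcont)
      obtain ⟨U₀, V₀, hU₀, hV₀, h₀⟩ := ih
      obtain ⟨⟨U, V⟩, ⟨⟨hU, hV⟩, hB⟩, hmax⟩ := hS.exists_isMaxOn ⟨(U₀, V₀), ⟨hU₀, hV₀⟩, h₀⟩
        (f := fun p => ‖(p.1 * X * p.2) ⟨k, hm⟩ ⟨k, hn⟩‖)
        (hcont.matrix_elem _ _).norm.continuousOn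
      change IsUnitaryMat U at hU
      change IsUnitaryMat V at hV
      change IsDiagUpTo k (U * X * V) at hB
      have hcol : ∀ i : Fin m, k < i → (U * X * V) i ⟨k, hn⟩ = 0 := by
        intro i hi
        by_contra hne
        obtain ⟨H, hH, hHB, hlt⟩ := hB.exists_isUnitaryMat_mul hi hm hn hne
        rw [← Matrix.mul_assoc, ← Matrix.mul_assoc] at hHB hlt
        exact hlt.not_ge (hmax (a := (H * U, V)) ⟨⟨hH.mul hU, hV⟩, hHB⟩)
      have hrow : ∀ j : Fin n, k < j → (U * X * V) ⟨k, hm⟩ j = 0 := by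
        intro j hj
        by_contra hne
        obtain ⟨H, hH, hHB, hlt⟩ := hB.conjTranspose.exists_isUnitaryMat_mul hj hn hm
          (by rwa [Matrix.conjTranspose_apply, Ne, star_eq_zero])
        have e : H * (U * X * V)ᴴ = (U * X * (V * Hᴴ))ᴴ := by
          rw [← Matrix.mul_assoc (U * X), Matrix.conjTranspose_mul _ Hᴴ,
            Matrix.conjTranspose_conjTranspose]
        rw [e] at hHB hlt
        rw [Matrix.conjTranspose_apply, Matrix.conjTranspose_apply, norm_star, norm_star] at hlt
        have hHB' := hHB.conjTranspose
        rw [Matrix.conjTranspose_conjTranspose] at hHB'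
        exact hlt.not_ge (hmax (a := (U, V * Hᴴ)) ⟨⟨hU, hV.mul hH.conjTranspose⟩, hHB'⟩)
      refine ⟨U, V, hU, hV, fun i j hij h => ?_⟩
      by_cases h' : (i : ℕ) < k ∨ (j : ℕ) < k
      · exact hB i j hij h'
      by_cases hi : (i : ℕ) = k
      · obtain rfl : i = ⟨k, hm⟩ := Fin.ext hi
        exact hrow j (by omega)
      · obtain rfl : j = ⟨k, hn⟩ := Fin.ext (by simp only; omega)
        exact hcol i (by omega)
    · obtain ⟨U, V, hU, hV, h⟩ := ih
      refine ⟨U, V, hU, hV, fun i j hij _ => h i j hij ?_⟩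
      have := i.isLt
      have := j.isLt
      omega

theorem exists_isSVD (X : Matrix (Fin m) (Fin n) K) : ∃ U D V, IsSVD X U D V := by
  obtain ⟨U, V, hU, hV, h⟩ := exists_isUnitaryMat_isDiagUpTo X m
  refine ⟨Uᴴ, U * X * V, V, ?_, hU.conjTranspose, hV, fun i j hij => h i j hij (.inl i.isLt)⟩
  rw [Matrix.mul_assoc, Matrix.mul_assoc, Matrix.mul_assoc, hV.mul_conjTranspose, Matrix.mul_one,
    ← Matrix.mul_assoc, show Uᴴ * U = 1 from hU, Matrix.one_mul]

end ConjugationAlgebra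

theorem DivKind.exists_isQRD (K : DivKind) {m n : ℕ} (X : Matrix (Fin m) (Fin n) K.Carrier) :
    ∃ Q R, IsQRD X Q R := by
  cases K
  · exact _root_.exists_isQRD (K := ℝ) X
  · exact _root_.exists_isQRD (K := ℂ) X
  · exact _root_.exists_isQRD (K := ℍ[ℝ]) X

theorem DivKind.exists_isSVD (K : DivKind) {m n : ℕ} (X : Matrix (Fin m) (Fin n) K.Carrier) :
    ∃ U D V, IsSVD X U D V := by
  cases K
  · exact _root_.exists_isSVD (K := ℝ) X
  · exact _root_.exists_isSVD (K := ℂ) X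
  · exact _root_.exists_isSVD (K := ℍ[ℝ]) X

/-! ### Components of matrices over a semisimple algebra -/

namespace WedderburnForm

variable {A : Type*} [Ring A] [Algebra ℝ A] {s : ℕ} {K : Fin s → DivKind} {d : Fin s → ℕ}
  {l m n : ℕ}

theorem toBlock_apply (φ : A ≃ₐ[ℝ] WedderburnForm K d) (X : Matrix (Fin m) (Fin n) A) (k : Fin s)
    (i : Fin m) (j : Fin n) (i' j' : Fin (d k)) :
    toBlock φ X k (finProdFinEquiv (i, i')) (finProdFinEquiv (j, j')) = φ (X i j) k i' j' := by
  simp only [toBlock, Matrix.of_apply, Equiv.symm_apply_apply]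

/-- Two block matrices agree if their entries agree, indexed by block and position in the block. -/
theorem blockMatrix_ext {R : Type*} {c : ℕ} {X Y : Matrix (Fin (m * c)) (Fin (n * c)) R}
    (h : ∀ i i' j j', X (finProdFinEquiv (i, i')) (finProdFinEquiv (j, j')) =
      Y (finProdFinEquiv (i, i')) (finProdFinEquiv (j, j'))) : X = Y := by
  ext p q
  obtain ⟨⟨i, i'⟩, rfl⟩ := finProdFinEquiv.surjective p
  obtain ⟨⟨j, j'⟩, rfl⟩ := finProdFinEquiv.surjective q
  exact h i i' j j'

theorem eq_of_toBlock_eq (φ : A ≃ₐ[ℝ] WedderburnForm K d) {X Y : Matrix (Fin m) (Fin n) A}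
    (h : ∀ k, toBlock φ X k = toBlock φ Y k) : X = Y := by
  rw [← ofBlocks_toBlock φ X, ← ofBlocks_toBlock φ Y, funext h]

theorem toBlock_mul (φ : A ≃ₐ[ℝ] WedderburnForm K d) (X : Matrix (Fin l) (Fin m) A)
    (Y : Matrix (Fin m) (Fin n) A) (k : Fin s) :
    toBlock φ (X * Y) k = toBlock φ X k * toBlock φ Y k := by
  refine blockMatrix_ext fun i i' j j' => ?_
  rw [toBlock_apply, Matrix.mul_apply, Matrix.mul_apply,
    ← Equiv.sum_comp finProdFinEquiv, Fintype.sum_prod_type]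
  simp only [toBlock_apply, map_sum, map_mul, Finset.sum_apply, Matrix.sum_apply, Pi.mul_apply,
    Matrix.mul_apply]

theorem toBlock_one (φ : A ≃ₐ[ℝ] WedderburnForm K d) (k : Fin s) :
    toBlock φ (1 : Matrix (Fin m) (Fin m) A) k = 1 := by
  refine blockMatrix_ext fun i i' j j' => ?_
  simp only [toBlock_apply, Matrix.one_apply, finProdFinEquiv.injective.eq_iff]
  by_cases hij : i = j
  · simp [hij, Matrix.one_apply]
  · simp [hij]

theorem toBlock_conjTranspose (φ : A ≃ₐ[ℝ] WedderburnForm K d) (X : Matrix (Fin m) (Fin n) A)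
    (k : Fin s) :
    letI : StarRing A := starRingOf φ
    toBlock φ Xᴴ k = (toBlock φ X k)ᴴ := by
  let : StarRing A := starRingOf φ
  refine blockMatrix_ext fun i i' j j' => ?_
  rw [toBlock_apply, Matrix.conjTranspose_apply, Matrix.conjTranspose_apply, toBlock_apply]
  change φ (φ.symm (star (φ (X j i)))) k i' j' = _
  rw [AlgEquiv.apply_symm_apply]
  rfl

theorem isUnitaryMat_ofBlocks (φ : A ≃ₐ[ℝ] WedderburnForm K d)
    {Q : ∀ k : Fin s, Matrix (Fin (m * d k)) (Fin (m * d k)) (K k).Carrier}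
    (h : ∀ k, IsUnitaryMat (Q k)) :
    letI : StarRing A := starRingOf φ
    IsUnitaryMat (ofBlocks φ Q) := by
  let : StarRing A := starRingOf φ
  refine eq_of_toBlock_eq φ fun k => ?_
  rw [toBlock_mul, toBlock_conjTranspose, toBlock_ofBlocks, toBlock_one]
  exact h k

theorem ofBlocks_apply_eq_zero (φ : A ≃ₐ[ℝ] WedderburnForm K d)
    {Y : ∀ k : Fin s, Matrix (Fin (m * d k)) (Fin (n * d k)) (K k).Carrier} {i : Fin m} {j : Fin n}
    (h : ∀ k i' j', Y k (finProdFinEquiv (i, i')) (finProdFinEquiv (j, j')) = 0) :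
    ofBlocks φ Y i j = 0 := by
  apply φ.injective
  funext k
  ext i' j'
  simp only [ofBlocks, Matrix.of_apply, AlgEquiv.apply_symm_apply, map_zero]
  exact h k i' j'

/-- A block standing to the left of another one has smaller indices throughout. -/
theorem finProdFinEquiv_lt {c : ℕ} {i : Fin m} {j : Fin n} (h : (j : ℕ) < i) (i' j' : Fin c) :
    (finProdFinEquiv (j, j') : ℕ) < finProdFinEquiv (i, i') := by
  simp only [finProdFinEquiv_apply_val]
  have h1 : c * (j + 1) ≤ c * (i : ℕ) := Nat.mul_le_mul_left c h
  have h2 := j'.isLt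
  rw [mul_add, mul_one] at h1
  omega

theorem isUpperTri_ofBlocks (φ : A ≃ₐ[ℝ] WedderburnForm K d)
    {R : ∀ k : Fin s, Matrix (Fin (m * d k)) (Fin (n * d k)) (K k).Carrier}
    (h : ∀ k, IsUpperTri (R k)) : IsUpperTri (ofBlocks φ R) := fun _ _ hij =>
  ofBlocks_apply_eq_zero φ fun k i' j' => h k _ _ (finProdFinEquiv_lt hij i' j')

theorem isRectDiag_ofBlocks (φ : A ≃ₐ[ℝ] WedderburnForm K d)
    {D : ∀ k : Fin s, Matrix (Fin (m * d k)) (Fin (n * d k)) (K k).Carrier}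
    (h : ∀ k, IsRectDiag (D k)) : IsRectDiag (ofBlocks φ D) := fun _ _ hij =>
  ofBlocks_apply_eq_zero φ fun k i' j' => h k _ _ <| by
    rcases lt_or_gt_of_ne hij with h | h
    · exact (finProdFinEquiv_lt h j' i').ne
    · exact (finProdFinEquiv_lt h i' j').ne'

theorem isQRD_ofBlocks (φ : A ≃ₐ[ℝ] WedderburnForm K d) {X : Matrix (Fin m) (Fin n) A}
    {Q : ∀ k : Fin s, Matrix (Fin (m * d k)) (Fin (m * d k)) (K k).Carrier}
    {R : ∀ k : Fin s, Matrix (Fin (m * d k)) (Fin (n * d k)) (K k).Carrier}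
    (h : ∀ k, IsQRD (toBlock φ X k) (Q k) (R k)) :
    letI : StarRing A := starRingOf φ
    IsQRD X (ofBlocks φ Q) (ofBlocks φ R) := by
  let : StarRing A := starRingOf φ
  refine ⟨eq_of_toBlock_eq φ fun k => ?_, isUnitaryMat_ofBlocks φ fun k => (h k).unitary,
    isUpperTri_ofBlocks φ fun k => (h k).upperTri⟩
  rw [toBlock_mul, toBlock_ofBlocks, toBlock_ofBlocks]
  exact (h k).eq_mul

theorem isSVD_ofBlocks (φ : A ≃ₐ[ℝ] WedderburnForm K d) {X : Matrix (Fin m) (Fin n) A}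
    {U : ∀ k : Fin s, Matrix (Fin (m * d k)) (Fin (m * d k)) (K k).Carrier}
    {D : ∀ k : Fin s, Matrix (Fin (m * d k)) (Fin (n * d k)) (K k).Carrier}
    {V : ∀ k : Fin s, Matrix (Fin (n * d k)) (Fin (n * d k)) (K k).Carrier}
    (h : ∀ k, IsSVD (toBlock φ X k) (U k) (D k) (V k)) :
    letI : StarRing A := starRingOf φ
    IsSVD X (ofBlocks φ U) (ofBlocks φ D) (ofBlocks φ V) := by
  let : StarRing A := starRingOf φ
  refine ⟨eq_of_toBlock_eq φ fun k => ?_, isUnitaryMat_ofBlocks φ fun k => (h k).unitary_left,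
    isUnitaryMat_ofBlocks φ fun k => (h k).unitary_right,
    isRectDiag_ofBlocks φ fun k => (h k).diag⟩
  rw [toBlock_mul, toBlock_mul, toBlock_conjTranspose, toBlock_ofBlocks, toBlock_ofBlocks,
    toBlock_ofBlocks]
  exact (h k).eq_mul

end WedderburnForm

/-! ### The representation and the decompositions -/

/-- The Wedderburn–Artin theorem over `ℝ`, with the division algebras named. -/
theorem exists_algEquiv_wedderburnForm (A : Type*) [Ring A] [Algebra ℝ A] [Module.Finite ℝ A]
    [IsSemisimpleRing A] :
    ∃ (s : ℕ) (K : Fin s → DivKind) (d : Fin s → ℕ),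
      (∀ k, 0 < d k) ∧ Nonempty (A ≃ₐ[ℝ] WedderburnForm K d) := by
  obtain ⟨s, D, d, _, _, _, hd, ⟨e⟩⟩ :=
    IsSemisimpleRing.exists_algEquiv_pi_matrix_divisionRing_finite ℝ A
  choose K f using fun k => exists_algEquiv_divKind (D k)
  exact ⟨s, K, d, fun k => Nat.pos_of_ne_zero (hd k).out,
    ⟨e.trans (AlgEquiv.piCongrRight fun k => (f k).some.mapMatrix)⟩⟩

theorem mainTheorem3 (A : Type*) [Ring A] [Algebra ℝ A] [Module.Finite ℝ A]
    [IsSemisimpleRing A] :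
    -- `A` has a presentation as a direct sum of matrix algebras over `ℝ`, `ℂ`, `ℍ`
    (∃ (s : ℕ) (K : Fin s → DivKind) (d : Fin s → ℕ),
      (∀ k, 0 < d k) ∧ Nonempty (A ≃ₐ[ℝ] WedderburnForm K d)) ∧
    -- and for every such presentation, with the involution of `A` induced by it:
    ∀ (s : ℕ) (K : Fin s → DivKind) (d : Fin s → ℕ) (φ : A ≃ₐ[ℝ] WedderburnForm K d),
      letI : StarRing A := WedderburnForm.starRingOf φ
      ∀ (m n : ℕ) (X : Matrix (Fin m) (Fin n) A),
        -- QR decompositions of the components exist, chosen independently of each other,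
        -- and any choice assembles to a QR decomposition of `X`
        (∀ k, ∃ Q R, IsQRD (WedderburnForm.toBlock φ X k) Q R) ∧
        (∀ (Q : ∀ k, Matrix (Fin (m * d k)) (Fin (m * d k)) (K k).Carrier)
          (R : ∀ k, Matrix (Fin (m * d k)) (Fin (n * d k)) (K k).Carrier),
          (∀ k, IsQRD (WedderburnForm.toBlock φ X k) (Q k) (R k)) →
            IsQRD X (WedderburnForm.ofBlocks φ Q) (WedderburnForm.ofBlocks φ R)) ∧
        (∃ Q R, IsQRD X Q R) ∧
        -- likewise for singular value decompositions
        (∀ k, ∃ U D V, IsSVD (WedderburnForm.toBlock φ X k) U D V) ∧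
        (∀ (U : ∀ k, Matrix (Fin (m * d k)) (Fin (m * d k)) (K k).Carrier)
          (D : ∀ k, Matrix (Fin (m * d k)) (Fin (n * d k)) (K k).Carrier)
          (V : ∀ k, Matrix (Fin (n * d k)) (Fin (n * d k)) (K k).Carrier),
          (∀ k, IsSVD (WedderburnForm.toBlock φ X k) (U k) (D k) (V k)) →
            IsSVD X (WedderburnForm.ofBlocks φ U) (WedderburnForm.ofBlocks φ D)
              (WedderburnForm.ofBlocks φ V)) ∧
        (∃ U D V, IsSVD X U D V) := by 
  refine ⟨exists_algEquiv_wedderburnForm A, ?_⟩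
  intro s K d φ m n X
  have hQR : ∀ k, ∃ Q R, IsQRD (WedderburnForm.toBlock φ X k) Q R := fun k =>
    (K k).exists_isQRD _
  have hSVD : ∀ k, ∃ U D V, IsSVD (WedderburnForm.toBlock φ X k) U D V := fun k =>
    (K k).exists_isSVD _
  refine ⟨hQR, fun Q R h => WedderburnForm.isQRD_ofBlocks φ h, ?_,
    hSVD, fun U D V h => WedderburnForm.isSVD_ofBlocks φ h, ?_⟩
  · choose Q R h using hQR
    exact ⟨_, _, WedderburnForm.isQRD_ofBlocks φ h⟩
  · choose U D V h using hSVD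
    exact ⟨_, _, _, WedderburnForm.isSVD_ofBlocks φ h⟩
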